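/- Let $\alpha\in(0,2)\setminus\{1\}$, $c_+,c_-\ge 0$ with $c_++c_->0$, $a>0$, and $\frac{1}{1+\alpha}<\beta<1$. Let $B_\alpha$ be a strictly $\alpha$-stable (càdlàg Lévy) process with Lévy measure $(c_+\mathbf 1_{u>0}+c_-\mathbf 1_{u<0})|u|^{-1-\alpha}\,\mathrm du$. Let $f:\mathbb R\to\mathbb R$ be a $\mathcal C^1$ function such that $f(x)/(a x^\beta)\to 1$ as $x\to+\infty$. Let $X=(X(t))_{t\ge 0}$ be a real càdlàg process with $X(0)$ independent of $B_\alpha$ that solves $$X(t)=X(0)+\int_0^t f(X(s))\,\mathrm ds+B_\alpha(t),\qquad t\ge 0,$$ almost surely, and assume that $\lim_{t\to\infty}X(t)=+\infty$ almost surely. Put $c_1=(a(1-\beta))^{1/(1-\beta)}$. Then the random variables $$\frac{X(\lambda)-c_1\lambda^{\frac1{1-\beta}}}{\lambda^{1/\alpha}},\qquad \lambda>0,$$ do not converge in distribution (to any real random variable) as $\lambda\to+\infty$. -/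

import Mathlib

open MeasureTheory ProbabilityTheory Filter Topology
open scoped NNReal ENNReal

/-- A path `x : [0, ∞) → ℝ` is càdlàg: right-continuous with finite left limits. -/
def IsCadlag (x : ℝ≥0 → ℝ) : Prop :=
  ∀ t : ℝ≥0, ContinuousWithinAt x (Set.Ici t) t ∧ ∃ l : ℝ, Tendsto x (𝓝[<] t) (𝓝 l)

/-- `B` is a real Lévy process under `P`. -/
structure IsLevyProcess {Ω : Type*} [MeasurableSpace Ω] (P : Measure Ω)
    (B : ℝ≥0 → Ω → ℝ) : Prop where
  measurable : ∀ t, Measurable (B t)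
  zero : ∀ᵐ ω ∂P, B 0 ω = 0
  indep_increments : HasIndepIncrements B P
  stationary_increments : ∀ s t : ℝ≥0,
    IdentDistrib (fun ω => B (s + t) ω - B s ω) (B t) P P
  cadlag : ∀ᵐ ω ∂P, IsCadlag (fun t => B t ω)

/-- `ν` is a Lévy measure on `ℝ`: no atom at `0` and `∫ min(1, u²) ν(du) < ∞`. -/
def IsLevyMeasure (ν : Measure ℝ) : Prop :=
  ν {0} = 0 ∧ ∫⁻ u, ENNReal.ofReal (min 1 (u ^ 2)) ∂ν < ∞

/-- The Lévy–Khintchine exponent with drift `b`, Gaussian variance `v` and Lévy measure `ν`,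
with truncation function `u ↦ u 1_{|u| ≤ 1}`. -/
noncomputable def levyKhintchineExponent (b : ℝ) (v : ℝ≥0) (ν : Measure ℝ) (θ : ℝ) : ℂ :=
  Complex.I * b * θ - v * θ ^ 2 / 2 +
    ∫ u : ℝ, (Complex.exp (Complex.I * θ * u) - 1 -
      Complex.I * θ * ((if |u| ≤ 1 then u else 0 : ℝ) : ℂ)) ∂ν

/-- The process `B` has Lévy measure `ν`: its one-dimensional laws are given by the
Lévy–Khintchine formula, for some drift, some Gaussian variance, and the Lévy measure `ν`. -/
def HasLevyMeasure {Ω : Type*} [MeasurableSpace Ω] (P : Measure Ω)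
    (B : ℝ≥0 → Ω → ℝ) (ν : Measure ℝ) : Prop :=
  IsLevyMeasure ν ∧ ∃ (b : ℝ) (v : ℝ≥0), ∀ (t : ℝ≥0) (θ : ℝ),
    charFun (P.map (B t)) θ = Complex.exp (((t : ℝ) : ℂ) * levyKhintchineExponent b v ν θ)

/-- The measure `(c₊ 1_{u > 0} + c₋ 1_{u < 0}) |u|^{-1-α} du` on `ℝ`. -/
noncomputable def stableLevyMeasure (α cp cm : ℝ) : Measure ℝ :=
  volume.withDensity fun u =>
    ENNReal.ofReal ((if 0 < u then cp else if u < 0 then cm else 0) * |u| ^ (-1 - α))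

/-- `B` is a strictly `α`-stable process with Lévy measure
`(c₊ 1_{u > 0} + c₋ 1_{u < 0}) |u|^{-1-α} du`: a Lévy process with this Lévy measure such that,
for every `r > 0`, the processes `t ↦ B (r t)` and `t ↦ r^{1/α} B t` have the same law. -/
structure IsStrictlyStableProcess {Ω : Type*} [MeasurableSpace Ω] (P : Measure Ω)
    (B : ℝ≥0 → Ω → ℝ) (α cp cm : ℝ) : Prop where
  levy : IsLevyProcess P B
  levyMeasure : HasLevyMeasure P B (stableLevyMeasure α cp cm)
  selfSimilar : ∀ r : ℝ≥0, 0 < r →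
    IdentDistrib (fun ω (t : ℝ≥0) => B (r * t) ω)
      (fun ω (t : ℝ≥0) => (r : ℝ) ^ (1 / α) * B t ω) P P

/-- `X` solves `dX(t) = f(X(t)) dt + dB(t)` for all `t ≥ 0`, the (possibly random) initial value
`X(0)` being independent of the driving process `B`. -/
structure IsSDESolution {Ω : Type*} [MeasurableSpace Ω] (P : Measure Ω)
    (f : ℝ → ℝ) (B X : ℝ≥0 → Ω → ℝ) : Prop where
  measurable : ∀ t, Measurable (X t)
  cadlag : ∀ᵐ ω ∂P, IsCadlag (fun t => X t ω)
  indep_initial : IndepFun (X 0) (fun ω (t : ℝ≥0) => B t ω) P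
  integral_eq : ∀ᵐ ω ∂P, ∀ t : ℝ≥0,
    X t ω = X 0 ω + (∫ s in (0 : ℝ)..(t : ℝ), f (X s.toNNReal ω)) + B t ω

/-! Suppose the rescaled variables converge, and let `γ = 1/(1-β)`. The condition on `β` says `1/α <
γ - 1`, so fluctuations of size `s^(1/α)` are negligible against the growth `s^(γ-1)` of the profile
`c₁ s^γ` per unit of time: for every `d > 0`, `X s` lies between `c₁ (s-d)^γ` and `c₁ (s+d)^γ` with
probability tending to one (`tendsto_measure_deviation`). The solution thus forgets any random time
lag.

This is incompatible with randomness at positive times. Let `h < h'` and suppose that `c ≤ X h` and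
`X h' ≤ c` both have positive probability. Run the equation from `c` with fresh noise for a time
`t`. By comparison and the Markov property, the result is unlikely to exceed the profile at time `t
+ (h+h')/2` (compare with `X (h+t)`), and unlikely to be below it (compare with `X (h'+t)`), a
contradiction (`IsSDESolution.measure_eq_zero_or`). Letting `h'` decrease to `h`, right-continuity
makes `X h` almost surely constant; the equation then makes `B 1` constant, which a nonzero Lévy
measure forbids.

Comparison and the Markov property are obtained through `eulerFlow`, a jointly measurable functional
of initial value and noise path, monotone in the former, which equals the solution along every
càdlàg path that solves the equation. -/

/-! ### Càdlàg paths -/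

/-- The smallest point of the grid `δ ℕ` to the right of `s`. -/
noncomputable def gridCeil (δ : ℝ≥0) (s : ℝ) : ℝ≥0 := (⌈s / δ⌉₊ : ℝ≥0) * δ

lemma le_gridCeil {δ : ℝ≥0} (hδ : 0 < δ) (s : ℝ) : s ≤ gridCeil δ s := by
  have hδ' : (0 : ℝ) < δ := by exact_mod_cast hδ
  have h := Nat.le_ceil (s / (δ : ℝ))
  rw [div_le_iff₀ hδ'] at h
  simpa [gridCeil] using h

lemma gridCeil_le_add {δ : ℝ≥0} (hδ : 0 < δ) {s : ℝ} (hs : 0 ≤ s) :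
    (gridCeil δ s : ℝ) ≤ s + δ := by
  have hδ' : (0 : ℝ) < δ := by exact_mod_cast hδ
  have h := (Nat.ceil_lt_add_one (a := s / (δ : ℝ)) (by positivity)).le
  have h2 := mul_le_mul_of_nonneg_right h hδ'.le
  rw [add_mul, div_mul_cancel₀ _ hδ'.ne', one_mul] at h2
  simpa [gridCeil] using h2

lemma gridCeil_eq {δ : ℝ≥0} (hδ : 0 < δ) {k : ℕ} {s : ℝ} (h1 : k * (δ : ℝ) < s)
    (h2 : s ≤ (k + 1) * (δ : ℝ)) : gridCeil δ s = ((k + 1 : ℕ) : ℝ≥0) * δ := by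
  have hδ' : (0 : ℝ) < δ := by exact_mod_cast hδ
  have : ⌈s / (δ : ℝ)⌉₊ = k + 1 := by
    rw [Nat.ceil_eq_iff (by omega)]
    constructor
    · rw [lt_div_iff₀ hδ']; simpa using h1
    · rw [div_le_iff₀ hδ']; simpa using h2
  rw [gridCeil, this]

lemma measurable_comp_gridCeil (x : ℝ≥0 → ℝ) (δ : ℝ≥0) :
    Measurable fun s : ℝ => x (gridCeil δ s) := by
  have h1 : Measurable fun s : ℝ => ⌈s / (δ : ℝ)⌉₊ := Nat.measurable_ceil.comp (by fun_prop)
  exact (measurable_from_nat (f := fun n : ℕ => x ((n : ℝ≥0) * δ))).comp h1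

/-- Grid points approach `s` from the right, so right-continuity suffices. -/
lemma tendsto_comp_gridCeil {x : ℝ≥0 → ℝ} {s : ℝ} (hs : 0 ≤ s)
    (hx : ContinuousWithinAt x (Set.Ici s.toNNReal) s.toNNReal) {δ : ℕ → ℝ≥0}
    (hδ : ∀ᶠ n in atTop, 0 < δ n) (hδ0 : Tendsto δ atTop (𝓝 0)) :
    Tendsto (fun n => x (gridCeil (δ n) s)) atTop (𝓝 (x s.toNNReal)) := by
  refine hx.tendsto.comp (tendsto_nhdsWithin_iff.2 ⟨?_, ?_⟩)
  · rw [← NNReal.tendsto_coe, Real.coe_toNNReal _ hs]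
    refine tendsto_of_tendsto_of_tendsto_of_le_of_le' tendsto_const_nhds
      (h := fun n => s + (δ n : ℝ)) ?_ ?_ ?_
    · have : Tendsto (fun n => (δ n : ℝ)) atTop (𝓝 0) := NNReal.tendsto_coe.2 hδ0
      simpa using this.const_add s
    · filter_upwards [hδ] with n hn using le_gridCeil hn s
    · filter_upwards [hδ] with n hn using gridCeil_le_add hn hs
  · filter_upwards [hδ] with n hn
    rw [Set.mem_Ici, ← NNReal.coe_le_coe, Real.coe_toNNReal _ hs]
    exact le_gridCeil hn s

lemma tendsto_div_nat_atTop_zero (T : ℝ≥0) :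
    Tendsto (fun n : ℕ => T / (n : ℝ≥0)) atTop (𝓝 0) := by
  rw [← NNReal.tendsto_coe]
  simpa using tendsto_const_div_atTop_nhds_zero_nat (T : ℝ)

lemma IsCadlag.measurable {x : ℝ≥0 → ℝ} (hx : IsCadlag x) : Measurable x := by
  refine measurable_of_tendsto_metrizable
    (f := fun (n : ℕ) (s : ℝ≥0) => x (gridCeil (1 / (n : ℝ≥0)) (s : ℝ)))
    (fun n => (measurable_comp_gridCeil x _).comp measurable_coe_nnreal_real)
    (tendsto_pi_nhds.2 fun s => ?_)
  have := tendsto_comp_gridCeil (s := (s : ℝ)) s.2 (x := x) (by simpa using (hx s).1)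
    (δ := fun n => 1 / (n : ℝ≥0)) ?_ (tendsto_div_nat_atTop_zero 1)
  · simpa using this
  · filter_upwards [eventually_gt_atTop 0] with n hn
    positivity

lemma IsCadlag.exists_bound {x : ℝ≥0 → ℝ} (hx : IsCadlag x) (T : ℝ≥0) :
    ∃ C : ℝ, ∀ t ≤ T, |x t| ≤ C := by
  have h := (isCompact_Icc (a := (0 : ℝ≥0)) (b := T)).induction_on
    (p := fun s => ∃ C : ℝ, ∀ t ∈ s, |x t| ≤ C) ⟨0, by simp⟩
    (fun s t hst ⟨C, hC⟩ => ⟨C, fun u hu => hC u (hst hu)⟩)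
    (fun s t ⟨C, hC⟩ ⟨D, hD⟩ => ⟨max C D, fun u hu => hu.elim
      (fun h => (hC u h).trans (le_max_left _ _)) (fun h => (hD u h).trans (le_max_right _ _))⟩) ?_
  · obtain ⟨C, hC⟩ := h
    exact ⟨C, fun t ht => hC t ⟨zero_le, ht⟩⟩
  · intro t _
    obtain ⟨h1, l, h2⟩ := hx t
    have h1' : ∀ᶠ u in 𝓝[≥] t, |x u| ≤ |x t| + 1 :=
      (h1.tendsto.abs.eventually_lt_const (lt_add_one _)).mono fun _ h => h.le
    have h2' : ∀ᶠ u in 𝓝[<] t, |x u| ≤ |l| + 1 :=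
      (h2.abs.eventually_lt_const (lt_add_one _)).mono fun _ h => h.le
    -- The left limit and right-continuity bound the path near each point; compactness does the
    -- rest.
    have h3 : ∀ᶠ u in 𝓝 t, |x u| ≤ max (|x t| + 1) (|l| + 1) := by
      rw [← nhdsLT_sup_nhdsGE, eventually_sup]
      exact ⟨h2'.mono fun _ h => h.trans (le_max_right _ _),
        h1'.mono fun _ h => h.trans (le_max_left _ _)⟩
    exact ⟨_, mem_nhdsWithin_of_mem_nhds h3, _, fun u hu => hu⟩

lemma IsCadlag.intervalIntegrable_comp {x : ℝ≥0 → ℝ} (hx : IsCadlag x) {f : ℝ → ℝ}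
    (hf : Continuous f) (s t : ℝ≥0) :
    IntervalIntegrable (fun u : ℝ => f (x u.toNNReal)) volume s t := by
  obtain ⟨C, hC⟩ := hx.exists_bound (max s t)
  obtain ⟨D, hD⟩ := (isCompact_Icc (a := -C) (b := C)).exists_bound_of_continuousOn
    hf.continuousOn
  refine (intervalIntegrable_const (c := D)).mono_fun
    (hf.measurable.comp (hx.measurable.comp measurable_real_toNNReal)).aestronglyMeasurable ?_
  refine (ae_restrict_iff' measurableSet_uIoc).2 (ae_of_all _ fun u hu => ?_)
  have h1 : u.toNNReal ≤ max s t := by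
    rw [Real.toNNReal_le_iff_le_coe, NNReal.coe_max]
    exact hu.2
  exact (hD _ (abs_le.1 (hC _ h1))).trans (le_abs_self D)

lemma IsCadlag.shift {x : ℝ≥0 → ℝ} (hx : IsCadlag x) (h : ℝ≥0) :
    IsCadlag fun t => x (h + t) := by
  intro t
  obtain ⟨h1, l, h2⟩ := hx (h + t)
  have hc : Tendsto (fun t : ℝ≥0 => h + t) (𝓝 t) (𝓝 (h + t)) :=
    (continuous_const.add continuous_id).tendsto t
  refine ⟨h1.tendsto.comp ?_, l, h2.comp ?_⟩
  · refine tendsto_nhdsWithin_iff.2 ⟨hc.mono_left nhdsWithin_le_nhds, ?_⟩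
    filter_upwards [self_mem_nhdsWithin] with u hu
    exact add_le_add_right hu h
  · refine tendsto_nhdsWithin_iff.2 ⟨hc.mono_left nhdsWithin_le_nhds, ?_⟩
    filter_upwards [self_mem_nhdsWithin] with u hu
    exact add_lt_add_right hu h

lemma IsCadlag.sub_const {x : ℝ≥0 → ℝ} (hx : IsCadlag x) (c : ℝ) :
    IsCadlag fun t => x t - c := by
  intro t
  obtain ⟨h1, l, h2⟩ := hx t
  exact ⟨h1.sub continuousWithinAt_const, l - c, h2.sub_const c⟩

/-! ### The flow as an iterated limit of Euler schemes -/

/-- The Euler scheme with step `δ` for `z' = g (z + b)`, `z 0 = x`. -/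
noncomputable def eulerScheme (g : ℝ → ℝ) (b : ℝ≥0 → ℝ) (δ : ℝ≥0) (x : ℝ) : ℕ → ℝ
  | 0 => x
  | k + 1 => eulerScheme g b δ x k + δ * g (eulerScheme g b δ x k + b (((k + 1 : ℕ) : ℝ≥0) * δ))

/-- The function `f` frozen outside of `[-m, m]`. -/
noncomputable def truncateArg (f : ℝ → ℝ) (m : ℕ) (x : ℝ) : ℝ := f (max (-m) (min m x))

/-- The value at time `T` of the solution of `dx = f(x) dt + db`, `x 0 = x`, obtained as a limit
of Euler schemes. -/
noncomputable def eulerFlow (f : ℝ → ℝ) (T : ℝ≥0) (x : ℝ) (b : ℝ≥0 → ℝ) : EReal :=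
  limsup (fun m : ℕ => limsup (fun n : ℕ =>
    ((eulerScheme (truncateArg f m) b (T / n) x n + b T : ℝ) : EReal)) atTop) atTop

lemma exists_lipschitzWith_truncateArg {f : ℝ → ℝ} (hf : ContDiff ℝ 1 f) (m : ℕ) :
    ∃ K, LipschitzWith K (truncateArg f m) := by
  obtain ⟨K, hK⟩ := hf.contDiffOn.exists_lipschitzOnWith (s := Set.Icc (-(m : ℝ)) m) (by simp)
    (convex_Icc _ _) isCompact_Icc
  refine ⟨K, LipschitzWith.of_dist_le_mul fun x y => ?_⟩
  have hmem : ∀ x : ℝ, max (-(m : ℝ)) (min m x) ∈ Set.Icc (-(m : ℝ)) m := fun x =>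
    ⟨le_max_left _ _, max_le (by linarith [(Nat.cast_nonneg m : (0 : ℝ) ≤ m)]) (min_le_left _ _)⟩
  refine (hK.dist_le_mul _ (hmem x) _ (hmem y)).trans ?_
  gcongr
  have h : LipschitzWith 1 fun x : ℝ => max (-(m : ℝ)) (min m x) :=
    (LipschitzWith.id.const_min _).const_max _
  simpa using h.dist_le_mul x y

lemma truncateArg_of_abs_le {f : ℝ → ℝ} {m : ℕ} {x : ℝ} (h : |x| ≤ m) :
    truncateArg f m x = f x := by
  rw [abs_le] at h
  rw [truncateArg, min_eq_right h.2, max_eq_right h.1]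

/-- One step is `u ↦ u + δ g(u + c)`, which is nondecreasing as soon as `K δ ≤ 1`. -/
lemma eulerScheme_mono {g : ℝ → ℝ} {K δ : ℝ≥0} (hg : LipschitzWith K g) (hδ : K * δ ≤ 1)
    (b : ℝ≥0 → ℝ) {x y : ℝ} (hxy : x ≤ y) (k : ℕ) :
    eulerScheme g b δ x k ≤ eulerScheme g b δ y k := by
  induction k with
  | zero => exact hxy
  | succ k ih =>
    simp only [eulerScheme]
    set u := eulerScheme g b δ x k
    set v := eulerScheme g b δ y k
    set c := b (((k + 1 : ℕ) : ℝ≥0) * δ)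
    have h := hg.dist_le_mul (u + c) (v + c)
    rw [Real.dist_eq, Real.dist_eq, show u + c - (v + c) = -(v - u) by ring, abs_neg,
      abs_of_nonneg (sub_nonneg.2 ih)] at h
    have h1 : g (u + c) - g (v + c) ≤ K * (v - u) := (le_abs_self _).trans h
    have h2 : (K : ℝ) * δ ≤ 1 := by exact_mod_cast hδ
    have h3 := mul_le_mul_of_nonneg_left h1 δ.2
    have h4 := mul_le_mul_of_nonneg_right h2 (sub_nonneg.2 ih)
    have : (δ : ℝ) * (g (u + c) - g (v + c)) ≤ v - u := by
      calc _ ≤ (δ : ℝ) * (K * (v - u)) := h3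
        _ = K * δ * (v - u) := by ring
        _ ≤ _ := by simpa using h4
    linarith [this, mul_sub (δ : ℝ) (g (u + c)) (g (v + c))]

lemma eulerScheme_congr {g : ℝ → ℝ} {b b' : ℝ≥0 → ℝ} {δ T : ℝ≥0} (h : ∀ s ≤ T, b s = b' s)
    (x : ℝ) {k : ℕ} (hk : k * δ ≤ T) : eulerScheme g b δ x k = eulerScheme g b' δ x k := by
  induction k with
  | zero => rfl
  | succ k ih =>
    have hk' : (k : ℝ≥0) * δ ≤ T := le_trans (by push_cast; gcongr; simp) hk
    simp only [eulerScheme]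
    rw [ih hk', h _ hk]

lemma measurable_eulerScheme {g : ℝ → ℝ} (hg : Measurable g) (δ : ℝ≥0) (k : ℕ) :
    Measurable fun p : ℝ × (ℝ≥0 → ℝ) => eulerScheme g p.2 δ p.1 k := by
  induction k with
  | zero => exact measurable_fst
  | succ k ih =>
    simp only [eulerScheme]
    have : Measurable fun p : ℝ × (ℝ≥0 → ℝ) => p.2 (((k + 1 : ℕ) : ℝ≥0) * δ) :=
      (measurable_pi_apply _).comp measurable_snd
    exact ih.add ((hg.comp (ih.add this)).const_mul _)

lemma eulerFlow_mono {f : ℝ → ℝ} (hf : ContDiff ℝ 1 f) (T : ℝ≥0) (b : ℝ≥0 → ℝ) :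
    Monotone fun x => eulerFlow f T x b := by
  intro x y hxy
  refine limsup_le_limsup (.of_forall fun m => limsup_le_limsup ?_)
  obtain ⟨K, hK⟩ := exists_lipschitzWith_truncateArg hf m
  have h : Tendsto (fun n : ℕ => K * (T / (n : ℝ≥0))) atTop (𝓝 0) := by
    simpa using (tendsto_div_nat_atTop_zero T).const_mul K
  filter_upwards [h.eventually_le_const zero_lt_one] with n hn
  rw [EReal.coe_le_coe_iff]
  gcongr
  exact eulerScheme_mono hK hn b hxy n

/-- Each scheme reads finitely many coordinates of the path, so the countable limsups are measurable
for the product σ-algebra. -/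
lemma measurable_eulerFlow {f : ℝ → ℝ} (hf : ContDiff ℝ 1 f) (T : ℝ≥0) :
    Measurable fun p : ℝ × (ℝ≥0 → ℝ) => eulerFlow f T p.1 p.2 := by
  refine Measurable.limsup fun m => Measurable.limsup fun n => measurable_coe_real_ereal.comp ?_
  obtain ⟨K, hK⟩ := exists_lipschitzWith_truncateArg hf m
  exact (measurable_eulerScheme hK.continuous.measurable _ _).add
    ((measurable_pi_apply T).comp measurable_snd)

lemma eulerFlow_congr (f : ℝ → ℝ) {b b' : ℝ≥0 → ℝ} {T : ℝ≥0} (h : ∀ s ≤ T, b s = b' s)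
    (x : ℝ) : eulerFlow f T x b = eulerFlow f T x b' := by
  have key : ∀ m n : ℕ, eulerScheme (truncateArg f m) b (T / n) x n =
      eulerScheme (truncateArg f m) b' (T / n) x n := by
    intro m n
    refine eulerScheme_congr h x ?_
    rcases eq_or_ne n 0 with rfl | hn
    · simp
    · rw [mul_div_cancel₀ _ (by exact_mod_cast hn)]
  simp only [eulerFlow, key, h T le_rfl]

/-! ### Discrete Grönwall inequality and convergence of the Euler schemes -/

lemma le_exp_mul_sum_of_le {e c : ℕ → ℝ} {r : ℝ} (hr : 0 ≤ r) (he0 : e 0 ≤ 0)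
    (hc : ∀ k, 0 ≤ c k) {N : ℕ} (he : ∀ k < N, e (k + 1) ≤ (1 + r) * e k + c k) :
    ∀ k ≤ N, e k ≤ Real.exp (r * k) * ∑ i ∈ Finset.range k, c i := by
  intro k hk
  induction k with
  | zero => simpa using he0
  | succ k ih =>
    have h1 := ih (by omega)
    have hS : 0 ≤ ∑ i ∈ Finset.range k, c i := Finset.sum_nonneg fun i _ => hc i
    have h2 : 1 + r ≤ Real.exp r := by linarith [Real.add_one_le_exp r]
    have h3 : Real.exp (r * ((k + 1 : ℕ) : ℝ)) = Real.exp r * Real.exp (r * k) := by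
      rw [← Real.exp_add]; push_cast; ring_nf
    have h4 : 1 ≤ Real.exp (r * ((k + 1 : ℕ) : ℝ)) := Real.one_le_exp (by positivity)
    calc e (k + 1) ≤ (1 + r) * e k + c k := he k (by omega)
      _ ≤ (1 + r) * (Real.exp (r * k) * ∑ i ∈ Finset.range k, c i) + c k := by gcongr
      _ ≤ Real.exp r * (Real.exp (r * k) * ∑ i ∈ Finset.range k, c i) +
          Real.exp (r * ((k + 1 : ℕ) : ℝ)) * c k := by
        gcongr
        exact le_mul_of_one_le_left (hc k) h4
      _ = _ := by rw [Finset.sum_range_succ, h3]; ring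

lemma IsCadlag.intervalIntegrable_abs_sub_gridCeil {b : ℝ≥0 → ℝ} (hb : IsCadlag b) {T δ : ℝ≥0}
    {n : ℕ} (hn : n * δ = T) {s t : ℝ} (hs : s ∈ Set.Icc 0 (T : ℝ)) (ht : t ∈ Set.Icc 0 (T : ℝ)) :
    IntervalIntegrable (fun u : ℝ => |b u.toNNReal - b (gridCeil δ u)|) volume s t := by
  obtain ⟨C, hC⟩ := hb.exists_bound T
  refine (intervalIntegrable_const (c := C + C)).mono_fun (Measurable.aestronglyMeasurable ?_) ?_
  · exact ((hb.measurable.comp measurable_real_toNNReal).sub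
      (measurable_comp_gridCeil b δ)).norm
  · refine (ae_restrict_iff' measurableSet_uIoc).2 (ae_of_all _ fun u hu => ?_)
    have hu2 : u ≤ T := hu.2.trans (max_le hs.2 ht.2)
    have h1 : u.toNNReal ≤ T := Real.toNNReal_le_iff_le_coe.2 hu2
    have h2 : gridCeil δ u ≤ T := by
      rw [gridCeil, ← hn]
      gcongr
      rw [Nat.ceil_le]
      rcases eq_or_ne δ 0 with rfl | hδ
      · simp
      · rw [div_le_iff₀ (by exact_mod_cast pos_of_ne_zero hδ)]
        rw [← hn] at hu2
        simpa using hu2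
    simp only [Real.norm_eq_abs, abs_abs]
    exact (abs_sub _ _).trans ((add_le_add (hC _ h1) (hC _ h2)).trans (le_abs_self _))

lemma IsCadlag.tendsto_integral_abs_sub_gridCeil {b : ℝ≥0 → ℝ} (hb : IsCadlag b) {T : ℝ≥0}
    (hT : 0 < T) :
    Tendsto (fun n : ℕ => ∫ u in (0 : ℝ)..T, |b u.toNNReal - b (gridCeil (T / n) u)|) atTop
      (𝓝 0) := by
  obtain ⟨C, hC⟩ := hb.exists_bound T
  have hpos : ∀ᶠ n : ℕ in atTop, 0 < T / (n : ℝ≥0) := by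
    filter_upwards [eventually_gt_atTop 0] with n hn
    positivity
  suffices h : Tendsto (fun n : ℕ => ∫ u in (0 : ℝ)..T, |b u.toNNReal - b (gridCeil (T / n) u)|)
      atTop (𝓝 (∫ _ in (0 : ℝ)..T, (0 : ℝ))) by simpa using h
  refine intervalIntegral.tendsto_integral_filter_of_dominated_convergence (fun _ => C + C)
    (.of_forall fun n => Measurable.aestronglyMeasurable ?_) ?_ intervalIntegrable_const
    (ae_of_all _ fun u hu => ?_)
  · exact ((hb.measurable.comp measurable_real_toNNReal).sub
      (measurable_comp_gridCeil b _)).norm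
  · filter_upwards [eventually_gt_atTop 0] with n hn
    refine ae_of_all _ fun u hu => ?_
    rw [Set.uIoc_of_le T.coe_nonneg] at hu
    have hn' : (0 : ℝ) < n := by exact_mod_cast hn
    have hT' : (0 : ℝ) < T := hT
    have h1 : u.toNNReal ≤ T := Real.toNNReal_le_iff_le_coe.2 hu.2
    have h2 : gridCeil (T / n) u ≤ T := by
      have : (n : ℝ≥0) * (T / n) = T := mul_div_cancel₀ _ (by exact_mod_cast hn.ne')
      rw [gridCeil]
      conv_rhs => rw [← this]
      gcongr
      rw [Nat.ceil_le]
      push_cast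
      rw [div_le_iff₀ (by positivity), mul_div_cancel₀ _ hn'.ne']
      exact hu.2
    rw [Real.norm_eq_abs, abs_abs]
    exact (abs_sub _ _).trans (add_le_add (hC _ h1) (hC _ h2))
  · rw [Set.uIoc_of_le T.coe_nonneg] at hu
    have := tendsto_comp_gridCeil hu.1.le (hb u.toNNReal).1 hpos (tendsto_div_nat_atTop_zero T)
    simpa using (this.const_sub (b u.toNNReal)).abs

/-- Subtracting the noise leaves a path `z` that is `M`-Lipschitz on `[0, T]`. Over one step the
scheme therefore errs by at most `K M δ²` plus `K` times the integrated oscillation of `b` against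
its grid values; Grönwall sums these errors, and the oscillation vanishes by dominated convergence.
-/
lemma IsCadlag.tendsto_eulerScheme {g : ℝ → ℝ} {K : ℝ≥0} (hg : LipschitzWith K g)
    {b z : ℝ≥0 → ℝ} (hb : IsCadlag b) {T : ℝ≥0} (hT : 0 < T)
    (hint : ∀ s t : ℝ≥0, IntervalIntegrable
      (fun u : ℝ => g (z u.toNNReal + b u.toNNReal)) volume s t)
    (hz : ∀ t ≤ T, z t = z 0 + ∫ u in (0 : ℝ)..t, g (z u.toNNReal + b u.toNNReal))
    {M : ℝ} (hM : ∀ t ≤ T, |g (z t + b t)| ≤ M) :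
    Tendsto (fun n : ℕ => eulerScheme g b (T / n) (z 0) n) atTop (𝓝 (z T)) := by
  have hM0 : 0 ≤ M := (abs_nonneg _).trans (hM 0 zero_le)
  have hzd : ∀ s t : ℝ≥0, s ≤ t → t ≤ T →
      z t - z s = ∫ u in (s : ℝ)..t, g (z u.toNNReal + b u.toNNReal) := by
    intro s t hst ht
    rw [hz t ht, hz s (hst.trans ht), add_sub_add_left_eq_sub,
      intervalIntegral.integral_interval_sub_left (by simpa using hint 0 t)
        (by simpa using hint 0 s)]
  have hzl : ∀ s t : ℝ≥0, s ≤ t → t ≤ T → |z t - z s| ≤ M * (t - s) := by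
    intro s t hst ht
    have hst' : (s : ℝ) ≤ t := hst
    rw [hzd s t hst ht]
    have := intervalIntegral.norm_integral_le_of_norm_le_const (a := (s : ℝ)) (b := t) (C := M)
      (f := fun u : ℝ => g (z u.toNNReal + b u.toNNReal)) fun u hu => by
        rw [Set.uIoc_of_le hst'] at hu
        exact hM _ (Real.toNNReal_le_iff_le_coe.2 (hu.2.trans ht))
    rwa [abs_of_nonneg (sub_nonneg.2 hst'), Real.norm_eq_abs] at this
  set R : ℕ → ℝ := fun n => ∫ u in (0 : ℝ)..T, |b u.toNNReal - b (gridCeil (T / n) u)| with hR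
  have key : ∀ n : ℕ, 0 < n → |eulerScheme g b (T / n) (z 0) n - z T| ≤
      Real.exp (K * T) * (K * M * T * (T / n : ℝ≥0) + K * R n) := by
    intro n hn
    set δ : ℝ≥0 := T / n with hδ
    have hδpos : 0 < δ := by positivity
    have hnδ : (n : ℝ≥0) * δ = T := mul_div_cancel₀ _ (by exact_mod_cast hn.ne')
    have hnδ' : (n : ℝ) * δ = T := by exact_mod_cast hnδ
    set p : ℕ → ℝ≥0 := fun k => (k : ℝ≥0) * δ with hp
    have hpT : ∀ k ≤ n, p k ≤ T := fun k hk => by rw [← hnδ]; simp only [hp]; gcongr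
    have hpd : ∀ k, (p (k + 1) : ℝ) - p k = δ := fun k => by simp only [hp]; push_cast; ring
    have hpm : ∀ k, p k ≤ p (k + 1) := fun k => by simp only [hp]; gcongr; simp
    have hpi : ∀ k ≤ n, (p k : ℝ) ∈ Set.Icc 0 (T : ℝ) := fun k hk => ⟨(p k).2, hpT k hk⟩
    set E : ℕ → ℝ := eulerScheme g b δ (z 0) with hE
    set r : ℕ → ℝ := fun k => ∫ u in (p k : ℝ)..p (k + 1), |b u.toNNReal - b (gridCeil δ u)|
    have hr0 : ∀ k, 0 ≤ r k := fun k =>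
      intervalIntegral.integral_nonneg (hpm k) fun u _ => abs_nonneg _
    have hri : ∀ k < n, IntervalIntegrable (fun u : ℝ => |b u.toNNReal - b (gridCeil δ u)|)
        volume (p k) (p (k + 1)) := fun k hk =>
      hb.intervalIntegrable_abs_sub_gridCeil hnδ (hpi k hk.le) (hpi (k + 1) hk)
    have hstep : ∀ k < n, |E (k + 1) - z (p (k + 1))| ≤
        (1 + K * δ) * |E k - z (p k)| + (K * M * δ ^ 2 + K * r k) := by
      intro k hk
      have h1 : E (k + 1) - z (p (k + 1)) = (E k - z (p k)) - ∫ u in (p k : ℝ)..p (k + 1),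
          (g (z u.toNNReal + b u.toNNReal) - g (E k + b (p (k + 1)))) := by
        rw [intervalIntegral.integral_sub (hint _ _) intervalIntegrable_const,
          ← hzd _ _ (hpm k) (hpT _ hk), intervalIntegral.integral_const, hpd, smul_eq_mul]
        simp only [hE, eulerScheme, hp]
        ring
      have h2 : ‖∫ u in (p k : ℝ)..p (k + 1),
          (g (z u.toNNReal + b u.toNNReal) - g (E k + b (p (k + 1))))‖ ≤
          ∫ u in (p k : ℝ)..p (k + 1), (K * (M * δ + |E k - z (p k)|) +
            K * |b u.toNNReal - b (gridCeil δ u)|) := by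
        refine intervalIntegral.norm_integral_le_of_norm_le (hpm k) (ae_of_all _ fun u hu => ?_)
          (intervalIntegrable_const.add ((hri k hk).const_mul _))
        have hu0 : 0 ≤ u := (p k).2.trans hu.1.le
        -- The scheme samples the noise at the right end of each cell, which is the value of
        -- `gridCeil` there.
        have hgc : gridCeil δ u = p (k + 1) := gridCeil_eq hδpos (by simpa [hp] using hu.1)
          (by simpa [hp] using hu.2)
        have hu1 : p k ≤ u.toNNReal := by
          rw [← NNReal.coe_le_coe, Real.coe_toNNReal _ hu0]; exact hu.1.le
        have hu2 : u.toNNReal ≤ p (k + 1) := Real.toNNReal_le_iff_le_coe.2 hu.2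
        have h3 := hzl _ _ hu1 (hu2.trans (hpT _ hk))
        have h4 : M * ((u.toNNReal : ℝ) - p k) ≤ M * δ := by
          gcongr
          rw [← hpd k]
          gcongr
        have h5 := hg.dist_le_mul (z u.toNNReal + b u.toNNReal) (E k + b (p (k + 1)))
        rw [Real.dist_eq, Real.dist_eq] at h5
        rw [hgc, Real.norm_eq_abs, ← mul_add]
        refine h5.trans ?_
        gcongr
        rw [show z u.toNNReal + b u.toNNReal - (E k + b (p (k + 1))) = (z u.toNNReal - z (p k)) -
          (E k - z (p k)) + (b u.toNNReal - b (p (k + 1))) by ring]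
        refine (abs_add_le _ _).trans ?_
        gcongr
        exact (abs_sub _ _).trans (add_le_add_left (h3.trans h4) _)
      rw [intervalIntegral.integral_add intervalIntegrable_const ((hri k hk).const_mul _),
        intervalIntegral.integral_const, intervalIntegral.integral_const_mul, hpd,
        Real.norm_eq_abs, smul_eq_mul] at h2
      rw [h1]
      refine (abs_sub _ _).trans ((add_le_add_right h2 _).trans (le_of_eq ?_))
      ring
    have h := le_exp_mul_sum_of_le (e := fun k => |E k - z (p k)|)
      (c := fun k => K * M * δ ^ 2 + K * r k) (r := K * δ) (by positivity)
      (by simp [hE, eulerScheme, hp]) (fun k => by have := hr0 k; positivity) hstep n le_rfl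
    have hsum : ∑ i ∈ Finset.range n, (K * M * δ ^ 2 + K * r i) = K * M * T * δ + K * R n := by
      rw [Finset.sum_add_distrib, Finset.sum_const, Finset.card_range, ← Finset.mul_sum,
        intervalIntegral.sum_integral_adjacent_intervals
          (a := fun k => (p k : ℝ)) (fun k hk => hri k hk), ← hnδ']
      simp only [hp, hR, hnδ, ← hδ, nsmul_eq_mul]
      simp
      ring
    simp only [hsum, hp, hnδ] at h
    rwa [mul_assoc, mul_comm (δ : ℝ), hnδ'] at h
  have hδ0 : Tendsto (fun n : ℕ => ((T / n : ℝ≥0) : ℝ)) atTop (𝓝 0) :=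
    NNReal.tendsto_coe.2 (tendsto_div_nat_atTop_zero T)
  have hlim := ((hδ0.const_mul (K * M * T : ℝ)).add
    ((hb.tendsto_integral_abs_sub_gridCeil hT).const_mul (K : ℝ))).const_mul (Real.exp (K * T))
  simp only [mul_zero, add_zero] at hlim
  rw [tendsto_iff_dist_tendsto_zero]
  refine squeeze_zero' (.of_forall fun _ => dist_nonneg) ?_ hlim
  filter_upwards [eventually_gt_atTop 0] with n hn
  rw [Real.dist_eq]
  exact key n hn

/-- The path is bounded on `[0, T]`, so truncation at a level above the bound is invisible to it;
the inner limit is then `x T` for all large `m`. -/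
theorem eulerFlow_eq {f : ℝ → ℝ} (hf : ContDiff ℝ 1 f) {b x : ℝ≥0 → ℝ} (hb : IsCadlag b)
    (hx : IsCadlag x)
    (hsol : ∀ t : ℝ≥0, x t = x 0 + (∫ s in (0 : ℝ)..t, f (x s.toNNReal)) + b t)
    {T : ℝ≥0} (hT : 0 < T) : eulerFlow f T (x 0) b = x T := by
  obtain ⟨C, hC⟩ := hx.exists_bound T
  obtain ⟨M, hM⟩ := (isCompact_Icc (a := -C) (b := C)).exists_bound_of_continuousOn
    hf.continuous.continuousOn
  have hb0 : b 0 = 0 := by simpa using hsol 0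
  have key : ∀ m : ℕ, C ≤ m → limsup (fun n : ℕ =>
      ((eulerScheme (truncateArg f m) b (T / n) (x 0) n + b T : ℝ) : EReal)) atTop = x T := by
    intro m hm
    obtain ⟨K, hK⟩ := exists_lipschitzWith_truncateArg hf m
    have htr : ∀ t ≤ T, truncateArg f m (x t) = f (x t) := fun t ht =>
      truncateArg_of_abs_le ((hC t ht).trans hm)
    have h := hb.tendsto_eulerScheme (z := fun t => x t - b t) hK hT (M := M)
      (by simpa using fun s t => hx.intervalIntegrable_comp hK.continuous s t) ?_ ?_
    · simp only [hb0, sub_zero] at h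
      have h2 : Tendsto (fun n : ℕ => eulerScheme (truncateArg f m) b (T / n) (x 0) n + b T)
          atTop (𝓝 (x T)) := by simpa using h.add_const (b T)
      exact ((continuous_coe_real_ereal.tendsto _).comp h2).limsup_eq
    · intro t ht
      simp only [sub_add_cancel, hb0, sub_zero]
      rw [hsol t, add_sub_cancel_right]
      congr 1
      refine intervalIntegral.integral_congr fun u hu => ?_
      rw [Set.uIcc_of_le t.coe_nonneg] at hu
      exact (htr _ ((Real.toNNReal_le_iff_le_coe.2 hu.2).trans ht)).symm
    · intro t ht
      simp only [sub_add_cancel]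
      rw [htr t ht]
      exact hM _ (abs_le.1 (hC t ht))
  obtain ⟨m₀, hm₀⟩ := exists_nat_ge C
  refine Tendsto.limsup_eq (tendsto_const_nhds.congr' ?_)
  filter_upwards [eventually_ge_atTop m₀] with m hm
  exact (key m (hm₀.trans (by exact_mod_cast hm))).symm

/-! ### The simple Markov property of Lévy processes -/

/-- Finitely many times are put on one monotone sequence, eventually constant, to apply independence
of increments. Starting at `0` makes sums of increments telescope to values of the process. -/
lemma exists_monotone_enumeration (K : Finset ℝ≥0) :
    ∃ τ : ℕ → ℝ≥0, Monotone τ ∧ τ 0 = 0 ∧ ∀ k ∈ K, ∃ j, τ j = k := by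
  classical
  set L := insert 0 K with hL
  have hpos : 0 < L.card := Finset.card_pos.2 ⟨0, by simp [hL]⟩
  have hlt : ∀ j, min j (L.card - 1) < L.card := fun j => by omega
  refine ⟨fun j => L.orderEmbOfFin rfl ⟨min j (L.card - 1), hlt j⟩, ?_, ?_, ?_⟩
  · intro i j hij
    refine (L.orderEmbOfFin rfl).monotone ?_
    rw [Fin.mk_le_mk]
    omega
  · have : (⟨min 0 (L.card - 1), hlt 0⟩ : Fin L.card) = ⟨0, hpos⟩ := by simp
    simp only [this, Finset.orderEmbOfFin_zero rfl hpos]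
    exact le_antisymm (Finset.min'_le _ _ (by simp [hL])) zero_le
  · intro k hk
    have : k ∈ Set.range (L.orderEmbOfFin rfl) := by
      rw [Finset.range_orderEmbOfFin]
      simp [hL, hk]
    obtain ⟨i, hi⟩ := this
    refine ⟨i, ?_⟩
    have h : (⟨min i (L.card - 1), hlt i⟩ : Fin L.card) = i :=
      Fin.ext (min_eq_left (by omega))
    simp only [h, hi]

lemma IsLevyProcess.identDistrib_sub {Ω : Type*} [MeasurableSpace Ω] {P : Measure Ω}
    {B : ℝ≥0 → Ω → ℝ} (hB : IsLevyProcess P B) {s t : ℝ≥0} (hst : s ≤ t) :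
    IdentDistrib (fun ω => B t ω - B s ω) (B (t - s)) P P := by
  have := hB.stationary_increments s (t - s)
  rwa [add_tsub_cancel_of_le hst] at this

section

variable {Ω : Type*} [MeasurableSpace Ω] {P : Measure Ω} [IsProbabilityMeasure P]
  {B : ℝ≥0 → Ω → ℝ}

/-- The increments of a Lévy process after time `h` have the law of the process itself. -/
theorem IsLevyProcess.identDistrib_shift (hB : IsLevyProcess P B) (h : ℝ≥0) :
    IdentDistrib (fun ω (t : ℝ≥0) => B (h + t) ω - B h ω) (fun ω (t : ℝ≥0) => B t ω) P P := by
  have hm := hB.measurable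
  refine (identDistrib_iff_forall_finset_identDistrib
    (X := fun t ω => B (h + t) ω - B h ω) (Y := B)
    (measurable_pi_lambda _ fun t => by fun_prop).aemeasurable
    (measurable_pi_lambda _ hm).aemeasurable).2 fun I => ?_
  obtain ⟨τ, hτ, hτ0, hτI⟩ := exists_monotone_enumeration I
  choose! idx hidx using hτI
  -- Both increment sequences are independent with marginals depending only on the lengths, so their
  -- laws are the same product measure.
  have hmap : P.map (fun ω i => B (h + τ (i + 1)) ω - B (h + τ i) ω) =
      P.map (fun ω i => B (τ (i + 1)) ω - B (τ i) ω) := by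
    have h1 := hB.indep_increments.nat (t := fun i => h + τ i)
      (fun i j hij => add_le_add_right (hτ hij) h)
    have h2 := hB.indep_increments.nat hτ
    rw [h1.map_fun_eq_infinitePi_map (by fun_prop), h2.map_fun_eq_infinitePi_map (by fun_prop)]
    congr 1
    ext1 i
    rw [(hB.identDistrib_sub (hτ (Nat.le_succ i))).map_eq,
      (hB.identDistrib_sub (add_le_add_right (hτ (Nat.le_succ i)) h)).map_eq,
      add_tsub_add_eq_tsub_left]
  have hD : IdentDistrib (fun ω (i : ℕ) => B (h + τ (i + 1)) ω - B (h + τ i) ω)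
      (fun ω i => B (τ (i + 1)) ω - B (τ i) ω) P P :=
    ⟨by fun_prop, by fun_prop, hmap⟩
  set F : (ℕ → ℝ) → (I → ℝ) := fun d i => ∑ k ∈ Finset.Ico 0 (idx i), d k with hF
  have hFm : Measurable F := by
    simp only [hF]
    fun_prop
  have h3 := hD.comp hFm
  have e1 : F ∘ (fun ω (i : ℕ) => B (h + τ (i + 1)) ω - B (h + τ i) ω) =
      fun ω => I.restrict fun t => B (h + t) ω - B h ω := by
    ext ω i
    simp only [hF, Function.comp_apply, Finset.restrict]
    rw [Finset.sum_Ico_sub (fun j => B (h + τ j) ω) (Nat.zero_le _), hidx _ i.2, hτ0, add_zero]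
  have e2 : F ∘ (fun ω (i : ℕ) => B (τ (i + 1)) ω - B (τ i) ω) =ᵐ[P]
      fun ω => I.restrict fun t => B t ω := by
    filter_upwards [hB.zero] with ω hω
    ext i
    simp only [hF, Function.comp_apply, Finset.restrict]
    rw [Finset.sum_Ico_sub (fun j => B (τ j) ω) (Nat.zero_le _), hidx _ i.2, hτ0, hω, sub_zero]
  rw [e1] at h3
  exact h3.trans (IdentDistrib.of_ae_eq h3.aemeasurable_snd e2)

/-- The increments of a Lévy process after time `h` are independent of its past. -/
theorem IsLevyProcess.indepFun_stopped_shift (hB : IsLevyProcess P B) (h : ℝ≥0) :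
    IndepFun (fun ω (s : ℝ≥0) => B (min s h) ω) (fun ω (t : ℝ≥0) => B (h + t) ω - B h ω) P := by
  classical
  have hm := hB.measurable
  refine IndepFun.process_indepFun_process (X := fun s ω => B (min s h) ω)
    (Y := fun t ω => B (h + t) ω - B h ω) (by fun_prop) (by fun_prop) fun I J => ?_
  obtain ⟨τ, hτ, hτ0, hτK⟩ := exists_monotone_enumeration
    (insert h (I.image (fun s => min s h) ∪ J.image (fun t => h + t)))
  obtain ⟨jh, hjh⟩ := hτK h (by simp)
  have hI : ∀ s ∈ I, ∃ j ≤ jh, τ j = min s h := by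
    intro s hs
    obtain ⟨j, hj⟩ := hτK (min s h) (by
      simp only [Finset.mem_insert, Finset.mem_union, Finset.mem_image]
      exact Or.inr (Or.inl ⟨s, hs, rfl⟩))
    rcases le_total j jh with hle | hle
    · exact ⟨j, hle, hj⟩
    -- The enumeration may repeat values; an index beyond `jh` forces `min s h = h`, and `jh` serves
    -- instead.
    · refine ⟨jh, le_rfl, le_antisymm ?_ ?_⟩
      · rw [← hj]; exact hτ hle
      · rw [hjh]; exact min_le_right _ _
  have hJ : ∀ t ∈ J, ∃ j, jh ≤ j ∧ τ j = h + t := by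
    intro t ht
    obtain ⟨j, hj⟩ := hτK (h + t) (by
      simp only [Finset.mem_insert, Finset.mem_union, Finset.mem_image]
      exact Or.inr (Or.inr ⟨t, ht, rfl⟩))
    rcases le_total jh j with hle | hle
    · exact ⟨j, hle, hj⟩
    · refine ⟨jh, le_rfl, le_antisymm ?_ ?_⟩
      · rw [hjh]; exact le_self_add
      · rw [← hj]; exact hτ hle
  choose! iI hiI hiI' using hI
  choose! iJ hiJ hiJ' using hJ
  set N := J.sup iJ
  have hN : ∀ t ∈ J, iJ t ≤ N := fun t ht => Finset.le_sup ht
  have hind := (hB.indep_increments.nat hτ).indepFun_finset (Finset.Ico 0 jh) (Finset.Ico jh N)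
    (Finset.Ico_disjoint_Ico_consecutive 0 jh N) (by fun_prop)
  -- The default value `0` is never reached: all indices summed lie in the block.
  set F : (Finset.Ico 0 jh → ℝ) → (I → ℝ) := fun d i =>
    ∑ k ∈ Finset.Ico 0 (iI i), if hk : k ∈ Finset.Ico 0 jh then d ⟨k, hk⟩ else 0 with hF
  set G : (Finset.Ico jh N → ℝ) → (J → ℝ) := fun d i =>
    ∑ k ∈ Finset.Ico jh (iJ i), if hk : k ∈ Finset.Ico jh N then d ⟨k, hk⟩ else 0 with hG
  have hFm : Measurable F := by
    refine measurable_pi_lambda _ fun i => Finset.measurable_sum _ fun k _ => ?_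
    by_cases hk : k ∈ Finset.Ico 0 jh
    · simp only [hk, dite_true]
      exact measurable_pi_apply _
    · simp only [hk, dite_false]
      exact measurable_const
  have hGm : Measurable G := by
    refine measurable_pi_lambda _ fun i => Finset.measurable_sum _ fun k _ => ?_
    by_cases hk : k ∈ Finset.Ico jh N
    · simp only [hk, dite_true]
      exact measurable_pi_apply _
    · simp only [hk, dite_false]
      exact measurable_const
  refine (hind.comp hFm hGm).congr ?_ ?_
  · filter_upwards [hB.zero] with ω hω
    ext i
    have h1 : ∀ k ∈ Finset.Ico 0 (iI i), k ∈ Finset.Ico 0 jh := fun k hk => by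
      have := hiI _ i.2
      rw [Finset.mem_Ico] at hk ⊢
      omega
    simp only [hF, Function.comp_apply]
    rw [Finset.sum_congr rfl fun k hk => dif_pos (h1 k hk),
      Finset.sum_Ico_sub (fun j => B (τ j) ω) (Nat.zero_le _), hiI' _ i.2, hτ0, hω, sub_zero]
  · refine .of_forall fun ω => ?_
    ext i
    have h1 : ∀ k ∈ Finset.Ico jh (iJ i), k ∈ Finset.Ico jh N := fun k hk => by
      have := hN _ i.2
      rw [Finset.mem_Ico] at hk ⊢
      omega
    simp only [hG, Function.comp_apply]
    rw [Finset.sum_congr rfl fun k hk => dif_pos (h1 k hk),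
      Finset.sum_Ico_sub (fun j => B (τ j) ω) (hiJ _ i.2), hiJ' _ i.2, hjh]

lemma ProbabilityTheory.IndepFun.prodMk_of_indepFun {α β γ : Type*} [MeasurableSpace α]
    [MeasurableSpace β] [MeasurableSpace γ] {Z : Ω → α} {U : Ω → β} {V : Ω → γ}
    (hZ : Measurable Z) (hU : Measurable U) (hV : Measurable V)
    (h : IndepFun Z (fun ω => (U ω, V ω)) P) (hUV : IndepFun U V P) :
    IndepFun (fun ω => (Z ω, U ω)) V P := by
  have : IsProbabilityMeasure (P.map Z) := Measure.isProbabilityMeasure_map hZ.aemeasurable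
  have : IsProbabilityMeasure (P.map U) := Measure.isProbabilityMeasure_map hU.aemeasurable
  have : IsProbabilityMeasure (P.map V) := Measure.isProbabilityMeasure_map hV.aemeasurable
  have h1 := h.map_prod_eq_prod_map_map hZ.aemeasurable (by fun_prop)
  have h2 := hUV.map_prod_eq_prod_map_map hU.aemeasurable hV.aemeasurable
  have h3 := (h.comp measurable_id measurable_fst).map_prod_eq_prod_map_map
    hZ.aemeasurable hU.aemeasurable
  refine (indepFun_iff_map_prod_eq_prod_map_map (by fun_prop) (by fun_prop)).2 ?_
  change P.map (fun ω => (Z ω, U ω)) = (P.map Z).prod (P.map U) at h3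
  rw [h3, ← MeasurableEquiv.prodAssoc.map_measurableEquiv_injective.eq_iff,
    Measure.prodAssoc_prod, ← h2, ← h1, Measure.map_map (by fun_prop) (by fun_prop)]
  rfl

end

/-! ### A process with a stable Lévy measure is not deterministic -/

/-- The integrand is at most `u²` for `|u| ≤ 1` and at most `2` otherwise, hence at most `2 min(1,
u²)`. -/
lemma IsLevyMeasure.integrable_compensated {ν : Measure ℝ} (hν : IsLevyMeasure ν) :
    Integrable (fun u : ℝ => Complex.exp (Complex.I * (1 : ℝ) * u) - 1 -
      Complex.I * (1 : ℝ) * ((if |u| ≤ 1 then u else 0 : ℝ) : ℂ)) ν := by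
  have hi : Integrable (fun u : ℝ => min 1 (u ^ 2)) ν := by
    refine ⟨by fun_prop, ?_⟩
    rw [hasFiniteIntegral_iff_ofReal (ae_of_all _ fun u => le_min zero_le_one (sq_nonneg u))]
    exact hν.2
  have hmeas : Measurable fun u : ℝ => if |u| ≤ 1 then u else 0 :=
    Measurable.ite (measurableSet_le (by fun_prop) (by fun_prop)) measurable_id measurable_const
  refine (hi.const_mul 2).mono' (Measurable.aestronglyMeasurable (by fun_prop))
    (ae_of_all _ fun u => ?_)
  by_cases hu : |u| ≤ 1
  · have h1 : ‖Complex.I * (1 : ℝ) * (u : ℂ)‖ = |u| := by simp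
    have h2 := Complex.norm_exp_sub_one_sub_id_le (x := Complex.I * (1 : ℝ) * (u : ℂ))
      (by rwa [h1])
    rw [h1, sq_abs] at h2
    have h3 : u ^ 2 ≤ 1 := by rwa [sq_le_one_iff_abs_le_one]
    rw [if_pos hu, min_eq_right h3]
    nlinarith [sq_nonneg u]
  · have h3 : 1 ≤ u ^ 2 := by
      rw [one_le_sq_iff_one_le_abs]
      exact (not_le.1 hu).le
    rw [if_neg hu, min_eq_left h3]
    have h4 : ‖Complex.exp (Complex.I * (1 : ℝ) * u)‖ = 1 := by
      rw [show Complex.I * (1 : ℝ) * (u : ℂ) = (u : ℂ) * Complex.I by push_cast; ring]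
      exact Complex.norm_exp_ofReal_mul_I u
    simp only [Complex.ofReal_zero, mul_zero, sub_zero]
    refine (norm_sub_le _ _).trans ?_
    rw [h4]
    norm_num

/-- The real part at `1` is `-v/2 - ∫ (1 - cos u) dν`, a sum of two nonpositive terms. -/
lemma ae_cos_eq_one_of_re_levyKhintchineExponent {ν : Measure ℝ} (hν : IsLevyMeasure ν) {b : ℝ}
    {v : ℝ≥0} (h : (levyKhintchineExponent b v ν 1).re = 0) : ∀ᵐ u ∂ν, Real.cos u = 1 := by
  have hint := hν.integrable_compensated
  have hre : ∀ u : ℝ, (Complex.exp (Complex.I * (1 : ℝ) * u) - 1 -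
      Complex.I * (1 : ℝ) * ((if |u| ≤ 1 then u else 0 : ℝ) : ℂ)).re = Real.cos u - 1 := by
    intro u
    rw [show Complex.I * (1 : ℝ) * (u : ℂ) = (u : ℂ) * Complex.I by push_cast; ring]
    simp [Complex.exp_ofReal_mul_I_re]
  have h1 : ∫ u : ℝ, (1 - Real.cos u) ∂ν = - (v : ℝ) / 2 := by
    have h2 : (∫ u : ℝ, (Complex.exp (Complex.I * (1 : ℝ) * u) - 1 -
        Complex.I * (1 : ℝ) * ((if |u| ≤ 1 then u else 0 : ℝ) : ℂ)) ∂ν).re =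
        ∫ u : ℝ, (Real.cos u - 1) ∂ν := by
      rw [← Complex.reCLM_apply, ← ContinuousLinearMap.integral_comp_comm _ hint]
      exact integral_congr_ae (ae_of_all _ hre)
    rw [levyKhintchineExponent, Complex.add_re, h2] at h
    have h3 : (Complex.I * b * (1 : ℝ) - v * ((1 : ℝ) : ℂ) ^ 2 / 2).re = -(v : ℝ) / 2 := by
      have : Complex.I * b * (1 : ℝ) - v * ((1 : ℝ) : ℂ) ^ 2 / 2 =
          ((-(v : ℝ) / 2 : ℝ) : ℂ) + (b : ℂ) * Complex.I := by
        push_cast; ring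
      rw [this]
      simp
    rw [h3] at h
    have h4 : ∫ u : ℝ, (1 - Real.cos u) ∂ν = - ∫ u : ℝ, (Real.cos u - 1) ∂ν := by
      rw [← integral_neg]
      simp
    linarith [v.coe_nonneg, integral_nonneg (μ := ν) (f := fun u : ℝ => 1 - Real.cos u)
      (fun u => by simpa using Real.cos_le_one u)]
  have hnn : 0 ≤ fun u : ℝ => 1 - Real.cos u := fun u => by simpa using Real.cos_le_one u
  have h0 : ∫ u : ℝ, (1 - Real.cos u) ∂ν = 0 :=
    le_antisymm (by rw [h1]; linarith [v.coe_nonneg]) (integral_nonneg hnn)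
  have hic : Integrable (fun u : ℝ => 1 - Real.cos u) ν := by
    refine hint.re.neg.congr (ae_of_all _ fun u => ?_)
    have := hre u
    simp only [Pi.neg_apply, RCLike.re_to_complex] at this ⊢
    rw [this]
    ring
  filter_upwards [(integral_eq_zero_iff_of_nonneg hnn hic).1 h0] with u hu
  simp only [Pi.zero_apply] at hu
  linarith

lemma not_ae_cos_eq_one_stableLevyMeasure {α cp cm : ℝ} (hcp : 0 ≤ cp)
    (hc : 0 < cp + cm) : ¬ ∀ᵐ u ∂(stableLevyMeasure α cp cm), Real.cos u = 1 := by
  intro h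
  have hm : Measurable fun u : ℝ => ENNReal.ofReal
      ((if 0 < u then cp else if u < 0 then cm else 0) * |u| ^ (-1 - α)) := by
    refine ENNReal.measurable_ofReal.comp (Measurable.mul ?_ (by fun_prop))
    exact Measurable.ite measurableSet_Ioi measurable_const
      (Measurable.ite measurableSet_Iio measurable_const measurable_const)
  rw [stableLevyMeasure, ae_withDensity_iff hm] at h
  have key : ∀ s : Set ℝ, volume s ≠ 0 → (∀ u ∈ s, u ≠ 0 ∧ |u| < 1 ∧
      0 < (if 0 < u then cp else if u < 0 then cm else 0)) → False := by
    intro s hs hsu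
    refine hs (measure_mono_null (fun u hu => ?_) h)
    obtain ⟨h0, h1, h2⟩ := hsu u hu
    simp only [Set.mem_compl_iff, Set.mem_ofPred_eq, not_forall]
    refine ⟨?_, fun hcos => h0 ?_⟩
    · rw [ne_eq, ENNReal.ofReal_eq_zero, not_le]
      exact mul_pos h2 (Real.rpow_pos_of_pos (abs_pos.2 h0) _)
    · have := Real.pi_gt_three
      rw [abs_lt] at h1
      exact (Real.cos_eq_one_iff_of_lt_of_lt (by linarith) (by linarith)).1 hcos
  rcases hcp.lt_or_eq with hp | hp
  · refine key (Set.Ioo 0 1) (by simp) fun u hu => ⟨hu.1.ne', ?_, ?_⟩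
    · rw [abs_of_pos hu.1]; exact hu.2
    · rwa [if_pos hu.1]
  · refine key (Set.Ioo (-1) 0) (by simp) fun u hu => ⟨hu.2.ne, ?_, ?_⟩
    · rw [abs_of_neg hu.2]; linarith [hu.1]
    · rw [if_neg hu.2.le.not_gt, if_pos hu.2]; linarith

/-- A constant has a characteristic function of modulus one, so the real part of the exponent would
vanish. -/
theorem HasLevyMeasure.not_ae_eq_const {Ω : Type*} [MeasurableSpace Ω] {P : Measure Ω}
    [IsProbabilityMeasure P] {B : ℝ≥0 → Ω → ℝ} {α cp cm : ℝ}
    (hB : HasLevyMeasure P B (stableLevyMeasure α cp cm)) (hcp : 0 ≤ cp)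
    (hc : 0 < cp + cm) (c : ℝ) : ¬ ∀ᵐ ω ∂P, B 1 ω = c := by
  intro h
  obtain ⟨hν, b, v, hch⟩ := hB
  refine not_ae_cos_eq_one_stableLevyMeasure hcp hc
    (ae_cos_eq_one_of_re_levyKhintchineExponent (b := b) (v := v) hν ?_)
  have hmap : P.map (B 1) = Measure.dirac c := by
    rw [Measure.map_congr (g := fun _ => c) h, Measure.map_const, measure_univ, one_smul]
  have h1 := congrArg norm (hch 1 1)
  rw [hmap, charFun_dirac] at h1
  simp only [NNReal.coe_one, Complex.ofReal_one, one_mul] at h1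
  rw [Complex.norm_exp_ofReal_mul_I, Complex.norm_exp] at h1
  exact (Real.exp_eq_one_iff _).1 h1.symm

/-! ### Deviations of the rescaled process -/

theorem tendsto_measure_abs_ge_of_tendstoInDistribution {Ω ι : Type*} [MeasurableSpace Ω]
    {P : Measure Ω} [IsProbabilityMeasure P] {Y : ι → Ω → ℝ} {l : Filter ι} {μ : Measure ℝ}
    [IsProbabilityMeasure μ] (h : TendstoInDistribution Y l (id : ℝ → ℝ) (fun _ => P) μ)
    {r : ι → ℝ} (hr : Tendsto r l atTop) :
    Tendsto (fun i => P {ω | r i ≤ |Y i ω|}) l (𝓝 0) := by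
  rw [ENNReal.tendsto_nhds_zero]
  intro ε hε
  have htight := tendsto_measure_norm_gt_of_isTightMeasureSet
    (isTightMeasureSet_singleton (μ := μ))
  simp only [Set.mem_singleton_iff, iSup_iSup_eq_left] at htight
  obtain ⟨R, hR⟩ := (htight.eventually_lt_const hε).exists
  -- The portmanteau bound needs a closed set; the margin `1` puts it inside the tail `‖x‖ > R`.
  have hF : IsClosed {x : ℝ | R + 1 ≤ ‖x‖} := isClosed_le continuous_const continuous_norm
  have hlim := ProbabilityMeasure.limsup_measure_closed_le_of_tendsto h.tendsto hF
  have hlt : (μ.map id) {x : ℝ | R + 1 ≤ ‖x‖} < ε := by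
    rw [Measure.map_id]
    refine (measure_mono fun x hx => ?_).trans_lt hR
    simp only [Set.mem_ofPred_eq] at hx ⊢
    linarith
  filter_upwards [eventually_lt_of_limsup_lt (hlim.trans_lt hlt), hr.eventually_ge_atTop (R + 1)]
    with i hi hri
  simp only [ProbabilityMeasure.coe_mk] at hi
  rw [Measure.map_apply_of_aemeasurable (h.forall_aemeasurable i) hF.measurableSet] at hi
  exact (measure_mono fun ω hω => hri.trans hω).trans hi.le

/-- Bernoulli's inequality for `1 + d/p`: the convex power lies above its tangent. -/
lemma mul_rpow_sub_one_le_sub {γ p d : ℝ} (hγ : 1 ≤ γ) (hp : 0 < p) (hd : 0 ≤ d) :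
    γ * d * p ^ (γ - 1) ≤ (p + d) ^ γ - p ^ γ := by
  have h := one_add_mul_self_le_rpow_one_add (s := d / p) (by
    have : 0 ≤ d / p := by positivity
    linarith) hγ
  have h2 : (p + d) ^ γ = p ^ γ * (1 + d / p) ^ γ := by
    rw [← Real.mul_rpow hp.le (by positivity)]
    congr 1
    field_simp
  have h3 : p ^ γ = p ^ (γ - 1) * p := by
    rw [← Real.rpow_add_one hp.ne']
    congr 1
    ring
  have h4 := mul_le_mul_of_nonneg_left h (Real.rpow_nonneg hp.le γ)
  rw [h2]
  have h5 : p ^ γ * (1 + γ * (d / p)) = p ^ γ + γ * d * p ^ (γ - 1) := by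
    rw [h3]
    field_simp
  linarith

theorem tendsto_measure_deviation {Ω : Type*} [MeasurableSpace Ω] {P : Measure Ω}
    [IsProbabilityMeasure P] {X : ℝ≥0 → Ω → ℝ} {c γ κ d : ℝ} (hc : 0 < c) (hγ : 1 ≤ γ)
    (hκ : κ < γ - 1) (hd : 0 < d) {μ : Measure ℝ} [IsProbabilityMeasure μ]
    (h : TendstoInDistribution (fun (l : ℝ≥0) (ω : Ω) => (X l ω - c * (l : ℝ) ^ γ) / (l : ℝ) ^ κ)
      atTop (id : ℝ → ℝ) (fun _ => P) μ) :
    Tendsto (fun s : ℝ≥0 => P {ω | c * ((s : ℝ) + d) ^ γ ≤ X s ω}) atTop (𝓝 0) ∧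
    Tendsto (fun s : ℝ≥0 => P {ω | X s ω ≤ c * ((s : ℝ) - d) ^ γ}) atTop (𝓝 0) := by
  -- The factor `(1/2)^(γ-1)` lets one rate serve both sides: `s - d ≥ s/2` once `s ≥ 2d`.
  have hr : Tendsto (fun s : ℝ≥0 => c * γ * d * (1 / 2) ^ (γ - 1) * (s : ℝ) ^ (γ - 1 - κ))
      atTop atTop := by
    refine Tendsto.const_mul_atTop (by positivity) ?_
    exact (tendsto_rpow_atTop (by linarith)).comp (NNReal.tendsto_coe_atTop.2 tendsto_id)
  have hlim := tendsto_measure_abs_ge_of_tendstoInDistribution h hr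
  have hbig : ∀ᶠ s : ℝ≥0 in atTop, 2 * d ≤ (s : ℝ) :=
    (NNReal.tendsto_coe_atTop.2 tendsto_id).eventually_ge_atTop (2 * d)
  have hrw : ∀ s : ℝ≥0, 0 < (s : ℝ) → c * γ * d * (1 / 2) ^ (γ - 1) * (s : ℝ) ^ (γ - 1 - κ) =
      c * (γ * d * ((s : ℝ) / 2) ^ (γ - 1)) / (s : ℝ) ^ κ := by
    intro s hs
    rw [Real.rpow_sub hs, div_eq_mul_one_div (s : ℝ) 2, Real.mul_rpow hs.le (by norm_num)]
    ring
  constructor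
  · refine tendsto_of_tendsto_of_tendsto_of_le_of_le' tendsto_const_nhds hlim
      (.of_forall fun _ => zero_le) ?_
    filter_upwards [hbig] with s hs
    refine measure_mono fun ω hω => ?_
    simp only [Set.mem_ofPred_eq] at hω ⊢
    have hs0 : 0 < (s : ℝ) := by linarith
    rw [hrw s hs0]
    refine le_trans ?_ (le_abs_self _)
    gcongr
    have h1 := mul_rpow_sub_one_le_sub hγ hs0 hd.le
    have h2 : γ * d * ((s : ℝ) / 2) ^ (γ - 1) ≤ γ * d * (s : ℝ) ^ (γ - 1) := by
      gcongr
      linarith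
    nlinarith [mul_le_mul_of_nonneg_left (h2.trans h1) hc.le]
  · refine tendsto_of_tendsto_of_tendsto_of_le_of_le' tendsto_const_nhds hlim
      (.of_forall fun _ => zero_le) ?_
    filter_upwards [hbig] with s hs
    refine measure_mono fun ω hω => ?_
    simp only [Set.mem_ofPred_eq] at hω ⊢
    have hs0 : 0 < (s : ℝ) := by linarith
    rw [hrw s hs0]
    refine le_trans ?_ (neg_le_abs _)
    rw [← neg_div]
    gcongr
    have h1 := mul_rpow_sub_one_le_sub (p := (s : ℝ) - d) hγ (by linarith) hd.le
    rw [sub_add_cancel] at h1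
    have h2 : γ * d * ((s : ℝ) / 2) ^ (γ - 1) ≤ γ * d * ((s : ℝ) - d) ^ (γ - 1) := by
      gcongr
      linarith
    nlinarith [mul_le_mul_of_nonneg_left (h2.trans h1) hc.le]

/-! ### Solutions of the equation restarted at a positive time -/

lemma integral_eq_shift {f : ℝ → ℝ} (hf : Continuous f) {x b : ℝ≥0 → ℝ} (hx : IsCadlag x)
    (hsol : ∀ t : ℝ≥0, x t = x 0 + (∫ s in (0 : ℝ)..t, f (x s.toNNReal)) + b t) (h t : ℝ≥0) :
    x (h + t) = x (h + 0) + (∫ s in (0 : ℝ)..t, f (x (h + s.toNNReal))) + (b (h + t) - b h) := by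
  have h1 : ∫ s in (0 : ℝ)..t, f (x (h + s.toNNReal)) =
      ∫ s in (h : ℝ)..(h + t : ℝ≥0), f (x s.toNNReal) := by
    have h2 := intervalIntegral.integral_comp_add_left (a := (0 : ℝ)) (b := t)
      (fun s => f (x s.toNNReal)) (h : ℝ)
    rw [add_zero, ← NNReal.coe_add] at h2
    rw [← h2]
    refine intervalIntegral.integral_congr fun u hu => ?_
    rw [Set.uIcc_of_le t.coe_nonneg] at hu
    simp only [Real.toNNReal_add h.coe_nonneg hu.1, Real.toNNReal_coe]
  have h3 := intervalIntegral.integral_add_adjacent_intervals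
    (by simpa using hx.intervalIntegrable_comp hf 0 h) (hx.intervalIntegrable_comp hf h (h + t))
  rw [h1, add_zero, hsol (h + t), hsol h, ← h3]
  ring

section

variable {Ω : Type*} [MeasurableSpace Ω] {P : Measure Ω} {f : ℝ → ℝ} {B X : ℝ≥0 → Ω → ℝ}

lemma IsSDESolution.ae_eulerFlow_shift_eq (hX : IsSDESolution P f B X) (hB : IsLevyProcess P B)
    (hf : ContDiff ℝ 1 f) (h : ℝ≥0) {T : ℝ≥0} (hT : 0 < T) :
    ∀ᵐ ω ∂P, eulerFlow f T (X h ω) (fun s => B (h + s) ω - B h ω) = X (h + T) ω := by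
  filter_upwards [hX.cadlag, hB.cadlag, hX.integral_eq] with ω h1 h2 h3
  have := eulerFlow_eq hf ((h2.shift h).sub_const (B h ω)) (h1.shift h)
    (integral_eq_shift hf.continuous h1 h3 h) hT
  simpa using this

variable [IsProbabilityMeasure P]

/-- The value of a solution at time `h` is independent of the increments of the noise after `h`. -/
theorem IsSDESolution.indepFun_shift (hX : IsSDESolution P f B X) (hB : IsLevyProcess P B)
    (hf : ContDiff ℝ 1 f) {h : ℝ≥0} (hh : 0 < h) :
    IndepFun (X h) (fun ω (t : ℝ≥0) => B (h + t) ω - B h ω) P := by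
  have hm := hB.measurable
  have hpast : Measurable fun ω (s : ℝ≥0) => B (min s h) ω :=
    measurable_pi_lambda _ fun s => hm _
  have hshift : Measurable fun ω (t : ℝ≥0) => B (h + t) ω - B h ω :=
    measurable_pi_lambda _ fun t => (hm _).sub (hm _)
  have h1 : IndepFun (X 0) (fun ω => ((fun s => B (min s h) ω : ℝ≥0 → ℝ),
      (fun t => B (h + t) ω - B h ω : ℝ≥0 → ℝ))) P :=
    hX.indep_initial.comp (φ := id)
      (ψ := fun b : ℝ≥0 → ℝ => ((fun s => b (min s h) : ℝ≥0 → ℝ),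
        (fun t => b (h + t) - b h : ℝ≥0 → ℝ))) measurable_id
      ((measurable_pi_lambda _ fun s => measurable_pi_apply _).prodMk
        (measurable_pi_lambda _ fun t => (measurable_pi_apply _).sub (measurable_pi_apply _)))
  -- `X h` is almost surely a measurable function of `X 0` and the noise stopped at `h`, a pair
  -- independent of the later increments.
  have h2 := h1.prodMk_of_indepFun (hX.measurable 0) hpast hshift (hB.indepFun_stopped_shift h)
  have h3 := h2.comp (φ := fun p : ℝ × (ℝ≥0 → ℝ) => (eulerFlow f h p.1 p.2).toReal)
    (measurable_eulerFlow hf h).ereal_toReal measurable_id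
  refine h3.congr ?_ .rfl
  filter_upwards [hX.cadlag, hB.cadlag, hX.integral_eq] with ω h4 h5 h6
  have h7 := eulerFlow_eq hf h5 h4 h6 hh
  rw [eulerFlow_congr f (b' := fun s => B (min s h) ω)
    (fun s hs => by rw [min_eq_left hs])] at h7
  simp [h7]

lemma IsLevyProcess.measure_eulerFlow_shift (hB : IsLevyProcess P B) (hf : ContDiff ℝ 1 f)
    (h t : ℝ≥0) (c : ℝ) {S : Set EReal} (hS : MeasurableSet S) :
    P {ω | eulerFlow f t c (fun s => B (h + s) ω - B h ω) ∈ S} =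
      P {ω | eulerFlow f t c (fun s => B s ω) ∈ S} :=
  (hB.identDistrib_shift h).measure_mem_eq (s := {b | eulerFlow f t c b ∈ S})
    ((measurable_eulerFlow hf t).comp measurable_prodMk_left hS)

/-- The two events become independent once the noise is replaced by its increments after `h`, and
`hAS` carries their intersection to the actual solution. The second factor does not depend on `h`,
so different starting times can be compared. -/
lemma IsSDESolution.measure_mul_le (hX : IsSDESolution P f B X) (hB : IsLevyProcess P B)
    (hf : ContDiff ℝ 1 f) {h t : ℝ≥0} (hh : 0 < h) (ht : 0 < t) (c : ℝ) {A : Set ℝ}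
    (hA : MeasurableSet A) {S : Set EReal} (hS : MeasurableSet S)
    (hAS : ∀ x ∈ A, ∀ b, eulerFlow f t c b ∈ S → eulerFlow f t x b ∈ S) :
    P {ω | X h ω ∈ A} * P {ω | eulerFlow f t c (fun s => B s ω) ∈ S} ≤
      P {ω | (X (h + t) ω : EReal) ∈ S} := by
  have hS' : MeasurableSet {b : ℝ≥0 → ℝ | eulerFlow f t c b ∈ S} :=
    (measurable_eulerFlow hf t).comp measurable_prodMk_left hS
  rw [← hB.measure_eulerFlow_shift hf h t c hS]
  have h1 := (hX.indepFun_shift hB hf hh).measure_inter_preimage_eq_mul A _ hA hS'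
  refine h1.symm.le.trans (measure_mono_ae ?_)
  filter_upwards [hX.ae_eulerFlow_shift_eq hB hf h ht] with ω h2 h3
  have h4 := hAS _ h3.1 _ h3.2
  rw [h2] at h4
  exact h4

/-- If the solution concentrates around a deterministic profile to the precision `o(1)` in time,
then the essential ranges of its values at two different positive times do not overlap. -/
theorem IsSDESolution.measure_eq_zero_or (hX : IsSDESolution P f B X) (hB : IsLevyProcess P B)
    (hf : ContDiff ℝ 1 f) {c₁ γ : ℝ}
    (hdev : ∀ d : ℝ, 0 < d →
      Tendsto (fun s : ℝ≥0 => P {ω | c₁ * ((s : ℝ) + d) ^ γ ≤ X s ω}) atTop (𝓝 0) ∧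
      Tendsto (fun s : ℝ≥0 => P {ω | X s ω ≤ c₁ * ((s : ℝ) - d) ^ γ}) atTop (𝓝 0))
    {h h' : ℝ≥0} (hh : 0 < h) (hhh' : h < h') (c : ℝ) :
    P {ω | c ≤ X h ω} = 0 ∨ P {ω | X h' ω ≤ c} = 0 := by
  have hd : 0 < ((h' : ℝ) - h) / 2 := by
    have : (h : ℝ) < h' := hhh'
    linarith
  obtain ⟨hup, -⟩ := hdev _ hd
  obtain ⟨-, hlow⟩ := hdev _ hd
  have hadd : ∀ u : ℝ≥0, Tendsto (fun t : ℝ≥0 => u + t) atTop atTop := fun u =>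
    tendsto_atTop_mono (fun t => le_add_self) tendsto_id
  -- With `d = (h' - h)/2`, the upper barrier from `h` and the lower barrier from `h'` coincide.
  set θ : ℝ≥0 → ℝ := fun t => c₁ * ((t : ℝ) + (h + h') / 2) ^ γ with hθ
  have hup' : Tendsto (fun t : ℝ≥0 => P {ω | θ t ≤ X (h + t) ω}) atTop (𝓝 0) := by
    refine (hup.comp (hadd h)).congr fun t => ?_
    simp only [Function.comp_apply, hθ, NNReal.coe_add]
    rw [show (h : ℝ) + t + ((h' : ℝ) - h) / 2 = t + (h + h') / 2 by ring]
  have hlow' : Tendsto (fun t : ℝ≥0 => P {ω | X (h' + t) ω ≤ θ t}) atTop (𝓝 0) := by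
    refine (hlow.comp (hadd h')).congr fun t => ?_
    simp only [Function.comp_apply, hθ, NNReal.coe_add]
    rw [show (h' : ℝ) + t - ((h' : ℝ) - h) / 2 = t + (h + h') / 2 by ring]
  set p := P {ω | c ≤ X h ω} with hp
  set q := P {ω | X h' ω ≤ c} with hq
  have hpq : ∀ t : ℝ≥0, 0 < t →
      p * q ≤ P {ω | θ t ≤ X (h + t) ω} + P {ω | X (h' + t) ω ≤ θ t} := by
    intro t ht
    have h1 := hX.measure_mul_le hB hf hh ht c (A := Set.Ici c) measurableSet_Ici
      (S := Set.Ici (θ t : EReal)) measurableSet_Ici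
      (fun x hx b hb => le_trans hb (eulerFlow_mono hf t b hx))
    have h2 := hX.measure_mul_le hB hf (hh.trans hhh') ht c (A := Set.Iic c) measurableSet_Iic
      (S := Set.Iic (θ t : EReal)) measurableSet_Iic
      (fun x hx b hb => le_trans (eulerFlow_mono hf t b hx) hb)
    simp only [Set.mem_Ici, Set.mem_Iic, EReal.coe_le_coe_iff] at h1 h2
    rw [← hp] at h1
    rw [← hq] at h2
    set u := P {ω | (θ t : EReal) ≤ eulerFlow f t c (fun s => B s ω)}
    set v := P {ω | eulerFlow f t c (fun s => B s ω) ≤ (θ t : EReal)}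
    -- The flow from `c` is either above or below the barrier, whatever the noise.
    have huv : 1 ≤ u + v := by
      rw [← measure_univ (μ := P)]
      refine (measure_mono fun ω _ => ?_).trans (measure_union_le _ _)
      exact le_total (θ t : EReal) _
    calc p * q ≤ p * q * (u + v) := le_mul_of_one_le_right zero_le huv
      _ = q * (p * u) + p * (q * v) := by ring
      _ ≤ 1 * (p * u) + 1 * (q * v) := by gcongr <;> exact prob_le_one
      _ ≤ _ := by rw [one_mul, one_mul]; gcongr
  have h0 : p * q ≤ 0 := by
    refine ge_of_tendsto (by simpa using hup'.add hlow') ?_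
    filter_upwards [eventually_gt_atTop 0] with t ht using hpq t ht
  simpa using h0

/-! ### From ordered essential ranges to a deterministic noise -/

lemma exists_ae_eq_const_of_forall_ae_le_or {Y : Ω → ℝ}
    (hY : ∀ c : ℝ, (∀ᵐ ω ∂P, Y ω < c) ∨ ∀ᵐ ω ∂P, c ≤ Y ω) : ∃ m : ℝ, ∀ᵐ ω ∂P, Y ω = m := by
  set A := {c : ℝ | ∀ᵐ ω ∂P, c ≤ Y ω} with hA
  have hnot : ∀ c, c ∉ A → ∀ᵐ ω ∂P, Y ω < c := fun c hc => (hY c).resolve_right hc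
  have hne : A.Nonempty := by
    by_contra hcon
    rw [Set.not_nonempty_iff_eq_empty] at hcon
    have : ∀ᵐ ω ∂P, ∀ n : ℕ, Y ω < -(n : ℝ) :=
      ae_all_iff.2 fun n => hnot _ (by simp [hcon])
    obtain ⟨ω, hω⟩ := this.exists
    obtain ⟨n, hn⟩ := exists_nat_ge (-Y ω)
    linarith [hω n]
  have hbdd : BddAbove A := by
    by_contra hcon
    have : ∀ᵐ ω ∂P, ∀ n : ℕ, (n : ℝ) ≤ Y ω := ae_all_iff.2 fun n => by
      obtain ⟨c, hc, hnc⟩ := not_bddAbove_iff.1 hcon n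
      filter_upwards [show ∀ᵐ ω ∂P, c ≤ Y ω from hc] with ω hω
      linarith
    obtain ⟨ω, hω⟩ := this.exists
    obtain ⟨n, hn⟩ := exists_nat_gt (Y ω)
    linarith [hω n]
  refine ⟨sSup A, ?_⟩
  have h1 : ∀ᵐ ω ∂P, ∀ n : ℕ, sSup A - 1 / ((n : ℝ) + 1) ≤ Y ω := ae_all_iff.2 fun n => by
    obtain ⟨c, hc, hlt⟩ := exists_lt_of_lt_csSup hne
      (sub_lt_self (sSup A) (Nat.one_div_pos_of_nat (α := ℝ) (n := n)))
    filter_upwards [show ∀ᵐ ω ∂P, c ≤ Y ω from hc] with ω hω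
    linarith
  have h2 : ∀ᵐ ω ∂P, ∀ n : ℕ, Y ω < sSup A + 1 / ((n : ℝ) + 1) := ae_all_iff.2 fun n => by
    refine hnot _ fun hmem => ?_
    linarith [le_csSup hbdd hmem, Nat.one_div_pos_of_nat (α := ℝ) (n := n)]
  filter_upwards [h1, h2] with ω h1 h2
  refine le_antisymm ?_ ?_
  · have := (tendsto_one_div_add_atTop_nhds_zero_nat (𝕜 := ℝ)).const_add (sSup A)
    rw [add_zero] at this
    exact ge_of_tendsto' this fun n => (h2 n).le
  · have := (tendsto_one_div_add_atTop_nhds_zero_nat (𝕜 := ℝ)).const_sub (sSup A)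
    rw [sub_zero] at this
    exact le_of_tendsto' this h1

/-- If `X h ≥ c` has positive probability, then `X h' > c` almost surely for each `h' > h`; as `h'`
decreases to `h`, right-continuity gives `X h ≥ c` almost surely. -/
lemma exists_ae_eq_const_of_measure_eq_zero_or (hcad : ∀ᵐ ω ∂P, IsCadlag fun t => X t ω)
    {h : ℝ≥0} (hX : ∀ h' : ℝ≥0, h < h' → ∀ c : ℝ,
      P {ω | c ≤ X h ω} = 0 ∨ P {ω | X h' ω ≤ c} = 0) : ∃ m : ℝ, ∀ᵐ ω ∂P, X h ω = m := by
  refine exists_ae_eq_const_of_forall_ae_le_or fun c => ?_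
  rw [or_iff_not_imp_left]
  intro hc
  have h0 : P {ω | c ≤ X h ω} ≠ 0 := fun h0 => hc <| by
    rw [ae_iff]
    simpa using h0
  have h1 : ∀ᵐ ω ∂P, ∀ n : ℕ, c < X (h + 1 / ((n : ℝ≥0) + 1)) ω := ae_all_iff.2 fun n => by
    have := (hX (h + 1 / ((n : ℝ≥0) + 1)) (lt_add_of_pos_right h (by positivity)) c).resolve_left h0
    rw [ae_iff]
    simpa using this
  filter_upwards [h1, hcad] with ω h1 h2
  have h3 : Tendsto (fun n : ℕ => h + 1 / ((n : ℝ≥0) + 1)) atTop (𝓝[≥] h) := by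
    refine tendsto_nhdsWithin_iff.2 ⟨?_, .of_forall fun n => Set.mem_Ici.2 le_self_add⟩
    have h4 : Tendsto (fun n : ℕ => 1 / ((n : ℝ≥0) + 1)) atTop (𝓝 0) := by
      rw [← NNReal.tendsto_coe]
      simpa using tendsto_one_div_add_atTop_nhds_zero_nat (𝕜 := ℝ)
    simpa using h4.const_add h
  exact ge_of_tendsto' ((h2 h).1.tendsto.comp h3) fun n => (h1 n).le

/-- If the values of a solution at positive times are deterministic, so is the noise. -/
theorem IsSDESolution.exists_noise_ae_eq_const (hX : IsSDESolution P f B X)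
    (hB : IsLevyProcess P B) (hf : Continuous f)
    (hdet : ∀ h : ℝ≥0, 0 < h → ∃ m : ℝ, ∀ᵐ ω ∂P, X h ω = m) : ∃ c : ℝ, ∀ᵐ ω ∂P, B 1 ω = c := by
  choose! x hx using hdet
  -- Countably many times keep the exceptional set null, and right-continuity recovers the others.
  -- Time starts at `1` because `X 0` may be random.
  have hgrid : ∀ᵐ ω ∂P, ∀ n k : ℕ,
      X (1 + (k : ℝ≥0) * (1 / (n : ℝ≥0))) ω = x (1 + (k : ℝ≥0) * (1 / (n : ℝ≥0))) :=
    ae_all_iff.2 fun n => ae_all_iff.2 fun k => hx _ (by positivity)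
  have hall : ∀ᵐ ω ∂P, IsCadlag (fun t => X t ω) ∧ (∀ t : ℝ≥0, X t ω = X 0 ω +
      (∫ s in (0 : ℝ)..t, f (X s.toNNReal ω)) + B t ω) ∧ ∀ n k : ℕ,
      X (1 + (k : ℝ≥0) * (1 / (n : ℝ≥0))) ω = x (1 + (k : ℝ≥0) * (1 / (n : ℝ≥0))) := by
    filter_upwards [hX.cadlag, hX.integral_eq, hgrid] with ω h1 h2 h3 using ⟨h1, h2, h3⟩
  obtain ⟨ω₀, hc₀, hs₀, hg₀⟩ := hall.exists
  have hpos : ∀ᶠ n : ℕ in atTop, 0 < 1 / (n : ℝ≥0) := by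
    filter_upwards [eventually_gt_atTop 0] with n hn
    positivity
  -- The equation expresses this increment through the path of `X` on `[1, 2]`; stationarity passes
  -- the conclusion to `B 1`.
  have hinc : ∀ᵐ ω ∂P, B (1 + 1) ω - B 1 ω = B (1 + 1) ω₀ - B 1 ω₀ := by
    filter_upwards [hall] with ω ⟨hc, hs, hg⟩
    have heq : ∀ s : ℝ≥0, X (1 + s) ω = X (1 + s) ω₀ := by
      intro s
      have hlim : ∀ ω', IsCadlag (fun t => X t ω') →
          Tendsto (fun n : ℕ => X (1 + gridCeil (1 / (n : ℝ≥0)) s) ω') atTop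
            (𝓝 (X (1 + s) ω')) := by
        intro ω' hω'
        have := tendsto_comp_gridCeil (x := fun t => X (1 + t) ω') s.coe_nonneg
          ((hω'.shift 1) _).1 hpos (tendsto_div_nat_atTop_zero 1)
        simpa only [Real.toNNReal_coe] using this
      refine tendsto_nhds_unique (hlim ω hc) ((hlim ω₀ hc₀).congr fun n => ?_)
      simp only [gridCeil]
      rw [hg, hg₀]
    have h1 := integral_eq_shift hf hc hs 1 1
    have h2 := integral_eq_shift hf hc₀ hs₀ 1 1
    simp only [heq] at h1
    linarith
  exact ⟨_, (hB.stationary_increments 1 1).ae_snd (p := fun y => y = B (1 + 1) ω₀ - B 1 ω₀)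
    (measurableSet_singleton _) hinc⟩

end

/-! ### The main theorem -/

theorem mainTheorem2 {Ω : Type*} [MeasurableSpace Ω] (P : Measure Ω) [IsProbabilityMeasure P]
    (α β a cp cm : ℝ) (hα0 : 0 < α) (hα2 : α < 2) (hα1 : α ≠ 1)
    (hcp : 0 ≤ cp) (hcm : 0 ≤ cm) (hc : 0 < cp + cm)
    (ha : 0 < a) (hβ : 1 / (1 + α) < β) (hβ1 : β < 1)
    (f : ℝ → ℝ) (hf : ContDiff ℝ 1 f)
    (hfa : Tendsto (fun x : ℝ => f x / (a * x ^ β)) atTop (𝓝 1))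
    (B X : ℝ≥0 → Ω → ℝ)
    (hB : IsStrictlyStableProcess P B α cp cm)
    (hX : IsSDESolution P f B X)
    (hXlim : ∀ᵐ ω ∂P, Tendsto (fun t : ℝ≥0 => X t ω) atTop atTop) :
    ¬ ∃ (μ : Measure ℝ) (_ : IsProbabilityMeasure μ),
      TendstoInDistribution
        (fun (l : ℝ≥0) (ω : Ω) =>
          (X l ω - (a * (1 - β)) ^ (1 / (1 - β)) * (l : ℝ) ^ (1 / (1 - β))) / (l : ℝ) ^ (1 / α))
        atTop (id : ℝ → ℝ) (fun _ => P) μ := by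
  rintro ⟨μ, _, hμ⟩
  have h1β : 0 < 1 - β := by linarith
  have hβ0 : 0 < β := lt_trans (by positivity) hβ
  have hc₁ : 0 < (a * (1 - β)) ^ (1 / (1 - β)) := by positivity
  have hγ : 1 ≤ 1 / (1 - β) := by
    rw [le_div_iff₀ h1β]
    linarith
  -- Equivalent to `1 - β < α β`, that is, to `β > 1/(1+α)`.
  have hκ : 1 / α < 1 / (1 - β) - 1 := by
    rw [div_lt_iff₀ (by positivity)] at hβ
    rw [lt_sub_iff_add_lt, div_add_one hα0.ne', div_lt_div_iff₀ hα0 h1β]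
    nlinarith
  have hdev := fun d hd => tendsto_measure_deviation hc₁ hγ hκ (d := d) hd hμ
  obtain ⟨c, hconst⟩ := hX.exists_noise_ae_eq_const hB.levy hf.continuous fun h hh =>
    exists_ae_eq_const_of_measure_eq_zero_or hX.cadlag fun h' hh' c =>
      hX.measure_eq_zero_or hB.levy hf hdev hh hh' c
  exact hB.levyMeasure.not_ae_eq_const hcp hc c hconst
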